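/- Let $\mathcal{X}$ be a finite set and let $\mathcal{M}$ be a finite set of 3-element subsets of $\mathcal{X}$ such that every element of $\mathcal{X}$ belongs to at least one member of $\mathcal{M}$. An exact cover (a solution of the instance $I=(\mathcal{X},\mathcal{M})$ of Exact Cover by 3-Sets) is a subcollection $\mathcal{R}\subseteq\mathcal{M}$ such that each element of $\mathcal{X}$ is contained in exactly one member of $\mathcal{R}$. Put $r:=3|\mathcal{M}|$ and let $G$ be the following simple graph. For each $M\in\mathcal{M}$ it contains a clique $C(M)$ on $r^2$ vertices, and in addition it contains a clique on $|\mathcal{X}|$ vertices $v(x)$, $x\in\mathcal{X}$; all these cliques are vertex-disjoint. There are no edges between $C(M)$ and $C(M')$ for $M\neq M'$, and $v(x)$ is joined to every vertex of $C(M)$ if $x\in M$ and to none of them if $x\notin M$. Let $m$ be the number of edges of $G$, let $n=|\mathcal{M}|\cdot r^2+|\mathcal{X}|$ be its number of vertices, and $p=\binom{n}{2}$. A clustering $\zeta$ of $G$ is a partition of its vertex set into nonempty clusters. Let $i_p(\zeta)=\sum_{C\in\zeta}\binom{|C|}{2}$ be the number of vertex pairs within clusters, let $i_e(\zeta)$ be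 the number of edges of $G$ with both endpoints in the same cluster, and define the surprise of $\zeta$ by $$S(\zeta)=\sum_{i=i_e(\zeta)}^{m}\frac{\binom{i_p(\zeta)}{i}\binom{p-i_p(\zeta)}{m-i}}{\binom{p}{m}},$$ where $\binom{a}{b}=0$ for $b>a$. Then there is a constant $c>0$, independent of the instance, such that for all such instances $(\mathcal{X},\mathcal{M})$ with $r\ge c$ the following holds: $(\mathcal{X},\mathcal{M})$ has an exact cover if and only if there exists a clustering $\zeta$ of $G$ with $$S(\zeta)\;\le\; k:=\binom{p}{m}^{-1}\cdot\binom{\binom{|\mathcal{M}|\cdot r^2+|\mathcal{X}|}{2}-|\mathcal{M}|\cdot\binom{r^2}{2}-|\mathcal{X}|\cdot r^2-|\mathcal{X}|}{(3|\mathcal{M}|-|\mathcal{X}|)\cdot r^2+\binom{|\mathcal{X}|}{2}-|\mathcal{X}|}.$$ -/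

import Mathlib

namespace SurpriseClustering

/-! ### Surprise of a clustering -/

section Surprise

variable {V : Type*} [Fintype V] [DecidableEq V]

/-- A clustering of a graph on `V` is a partition of `V` into nonempty clusters. -/
abbrev Clustering (V : Type*) [Fintype V] [DecidableEq V] : Type _ :=
  Finpartition (Finset.univ : Finset V)

/-- The number of vertex pairs of a graph on `V`. -/
def numPairs (V : Type*) [Fintype V] : ℕ := (Fintype.card V).choose 2

/-- The number of edges of `G`. -/
def numEdges (G : SimpleGraph V) [DecidableRel G.Adj] : ℕ := G.edgeFinset.card

/-- The number of vertex pairs inside the clusters of `ζ`. -/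
def intraPairs (ζ : Clustering V) : ℕ := ∑ C ∈ ζ.parts, C.card.choose 2

/-- The number of edges of `G` that have both endpoints in `C`. -/
def edgesWithin (G : SimpleGraph V) [DecidableRel G.Adj] (C : Finset V) : ℕ :=
  (G.edgeFinset.filter fun e => e ∈ C.sym2).card

/-- The number of intracluster edges of `ζ`. -/
def intraEdges (G : SimpleGraph V) [DecidableRel G.Adj] (ζ : Clustering V) : ℕ :=
  ∑ C ∈ ζ.parts, edgesWithin G C

/-- The surprise of the clustering `ζ` of `G`: the hypergeometric tail
`∑ i = i_e, …, m, (i_p choose i) * (p - i_p choose m - i) / (p choose m)`. -/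
noncomputable def surprise (G : SimpleGraph V) [DecidableRel G.Adj] (ζ : Clustering V) : ℝ :=
  ∑ i ∈ Finset.Icc (intraEdges G ζ) (numEdges G),
    (((intraPairs ζ).choose i : ℝ) *
        ((numPairs V - intraPairs ζ).choose (numEdges G - i) : ℝ)) /
      ((numPairs V).choose (numEdges G) : ℝ)

end Surprise

/-! ### Exact cover by 3-sets and the reduction -/

section Reduction

variable {X : Type*} [DecidableEq X]

/-- Some subcollection `R` of `M` contains each element of `X` in exactly one of its members. -/
def HasExactCover (M : Finset (Finset X)) : Prop :=
  ∃ R : Finset (Finset X), R ⊆ M ∧ ∀ x : X, ∃! S : Finset X, S ∈ R ∧ x ∈ S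

/-- The parameter `r = 3 |M|`. -/
def param (M : Finset (Finset X)) : ℕ := 3 * M.card

/-- Vertices of the constructed graph: one vertex for every element of `X`, and `r ^ 2` vertices
for every set in `M`. -/
abbrev RedVertex (M : Finset (Finset X)) : Type _ :=
  X ⊕ ({S : Finset X // S ∈ M} × Fin (param M ^ 2))

/-- Adjacency in the constructed graph: the element vertices form a clique, the vertices of each
set in `M` form a clique, and an element is linked to all clique vertices of each set that
contains it. -/
def redAdj (M : Finset (Finset X)) : RedVertex M → RedVertex M → Prop
  | .inl x, .inl y => x ≠ y
  | .inl x, .inr (S, _) => x ∈ S.1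
  | .inr (S, _), .inl x => x ∈ S.1
  | .inr (S, i), .inr (T, j) => S = T ∧ i ≠ j

instance redAdjDecidable (M : Finset (Finset X)) : DecidableRel (redAdj M)
  | .inl x, .inl y => inferInstanceAs (Decidable (x ≠ y))
  | .inl x, .inr (S, _) => inferInstanceAs (Decidable (x ∈ S.1))
  | .inr (S, _), .inl x => inferInstanceAs (Decidable (x ∈ S.1))
  | .inr (S, i), .inr (T, j) => inferInstanceAs (Decidable (S = T ∧ i ≠ j))

/-- The graph constructed from the instance `(X, M)`. -/
def redGraph (M : Finset (Finset X)) : SimpleGraph (RedVertex M) where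
  Adj := redAdj M
  symm := ⟨by
    rintro (x | ⟨S, i⟩) (y | ⟨T, j⟩) h
    · exact Ne.symm h
    · exact h
    · exact h
    · exact ⟨h.1.symm, h.2.symm⟩⟩
  loopless := ⟨by
    rintro (x | ⟨S, i⟩) h
    · exact h rfl
    · exact h.2 rfl⟩

instance redGraphDecidable (M : Finset (Finset X)) : DecidableRel (redGraph M).Adj :=
  redAdjDecidable M

/-- The threshold `k`. If `M` is nonempty and its members are 3-element sets that cover `X`, then
`3 ≤ |X| ≤ 3 |M|`, and none of the subtractions below truncates. -/
noncomputable def threshold [Fintype X] (M : Finset (Finset X)) : ℝ :=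
  ((numPairs (RedVertex M)).choose (numEdges (redGraph M)) : ℝ)⁻¹ *
    (((M.card * param M ^ 2 + Fintype.card X).choose 2 - M.card * (param M ^ 2).choose 2
        - Fintype.card X * param M ^ 2 - Fintype.card X).choose
      ((3 * M.card - Fintype.card X) * param M ^ 2 + (Fintype.card X).choose 2
        - Fintype.card X) : ℝ)

end Reduction

end SurpriseClustering

/-!
Since the factor `(p choose m)⁻¹` is common to both sides, the surprise is compared with the
threshold through the tail sum `∑ i ∈ [e, m], (a choose i) * (p - a choose m - i)`, where a
clustering has `a` intracluster pairs, of which `e` are edges. If every intracluster pair is an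
edge, the sum has the single nonzero term `(p - e choose m - e)`; in general it is at least that
large by Vandermonde's identity. The clusterings that come from exact covers have `a = e = c` for
`c = |M| * (r ^ 2 choose 2) + |X| * r ^ 2 + |X|`, and the threshold is the surprise belonging to
`a = e = c`. As `(p - e choose m - e)` strictly decreases in `e`, a clustering that meets the
threshold has `e ≥ c`.

Now take any clustering with `e ≥ c`. In each clique most vertices lie in one dominant cluster, as
every vertex outside it costs about `r ^ 2 / 2` edges, while at most `r ^ 3` edges leave the
cliques. If the dominant clusters are distinct, each element lies in at most one of them, and
`e ≥ c` leaves no slack: every element lies in the dominant cluster of a set that contains it, and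
the elements meet in full triples, so the clusters define an exact cover. If two cliques share
their dominant cluster, then at least `r ^ 4 / 4` intracluster pairs are not edges, so `a ≥ m + d`
for `d = 6 * r ^ 3`, and the tail sum is at least `(m + d choose m) ≥ ((m + 1) / d) ^ d ≥ r ^ d`.
This exceeds the threshold `(p - c choose m - c) ≤ p ^ (m - c) < (r ^ 6) ^ r ^ 3`.
-/

namespace SurpriseClustering

open Finset

section EdgeCounts

lemma two_mul_choose_two_add_self (n : ℕ) : 2 * n.choose 2 + n = n * n := by
  induction n with
  | zero => rfl
  | succ n ih =>
    rw [Nat.choose_succ_succ, Nat.choose_one_right]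
    linarith

variable {V : Type*} [Fintype V]

lemma numEdges_congr {G H : SimpleGraph V} [DecidableRel G.Adj] [DecidableRel H.Adj]
    (h : ∀ u v, G.Adj u v ↔ H.Adj u v) : numEdges G = numEdges H := by
  obtain rfl : G = H := by ext u v; exact h u v
  unfold numEdges
  congr!

lemma numEdges_mono {G H : SimpleGraph V} [DecidableRel G.Adj] [DecidableRel H.Adj]
    (h : G ≤ H) : numEdges G ≤ numEdges H :=
  card_le_card (SimpleGraph.edgeFinset_mono h)

lemma numEdges_add_card_mul_card_le {G H : SimpleGraph V} [DecidableRel G.Adj]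
    [DecidableRel H.Adj] (h : G ≤ H) {A B : Finset V} (hH : ∀ a ∈ A, ∀ b ∈ B, H.Adj a b)
    (hG : ∀ a ∈ A, ∀ b ∈ B, ¬ G.Adj a b) : numEdges G + #A * #B ≤ numEdges H := by
  classical
  have hinj : Set.InjOn Sym2.mk.uncurry ((A ×ˢ B : Finset (V × V)) : Set (V × V)) := by
    rintro ⟨a, b⟩ hab ⟨a', b'⟩ hab' heq
    rw [mem_coe, mem_product] at hab hab'
    obtain ⟨rfl, rfl⟩ | ⟨rfl, rfl⟩ := Sym2.eq_iff.1 heq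
    · rfl
    · exact absurd rfl (hH a hab.1 a hab'.2).ne
  rw [← card_product, ← card_image_of_injOn hinj, numEdges, ← card_union_of_disjoint]
  · refine card_le_card (union_subset (SimpleGraph.edgeFinset_mono h) ?_)
    simpa [image_subset_iff] using hH
  · rw [disjoint_right, forall_mem_image]
    rintro ⟨a, b⟩ hab
    rw [mem_product] at hab
    simpa using hG a hab.1 b hab.2

lemma numPairs_eq_numEdges_top [DecidableEq V] : numPairs V = numEdges (⊤ : SimpleGraph V) :=
  SimpleGraph.card_edgeFinset_top_eq_card_choose_two.symm

lemma numEdges_le_numPairs (G : SimpleGraph V) [DecidableRel G.Adj] : numEdges G ≤ numPairs V := by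
  classical
  exact numPairs_eq_numEdges_top (V := V) ▸ numEdges_mono le_top

lemma two_mul_numEdges_le (G : SimpleGraph V) [DecidableRel G.Adj] :
    2 * numEdges G ≤ Fintype.card V ^ 2 := by
  rw [sq, ← two_mul_choose_two_add_self]
  exact (Nat.mul_le_mul_left 2 (numEdges_le_numPairs G)).trans (Nat.le_add_right _ _)

lemma numEdges_lt_numPairs {G : SimpleGraph V} [DecidableRel G.Adj] (h : G ≠ ⊤) :
    numEdges G < numPairs V := by
  classical
  exact numPairs_eq_numEdges_top (V := V) ▸
    card_lt_card (SimpleGraph.edgeFinset_ssubset_edgeFinset.2 h.lt_top)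

lemma numEdges_sum {A B : Type*} [Fintype A] [Fintype B] (G : SimpleGraph (A ⊕ B))
    [DecidableRel G.Adj] [DecidableRel (G.comap Sum.inl).Adj]
    [DecidableRel (G.comap Sum.inr).Adj] :
    numEdges G = numEdges (G.comap Sum.inl) + numEdges (G.comap Sum.inr) +
      #{q : A × B | G.Adj (.inl q.1) (.inr q.2)} := by
  refine Nat.eq_of_mul_eq_mul_left two_pos ?_
  simp only [numEdges, mul_add, SimpleGraph.two_mul_card_edgeFinset, card_filter,
    Fintype.sum_prod_type, Fintype.sum_sum_type, sum_add_distrib, SimpleGraph.comap_adj]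
  have hswap : ∑ b, ∑ a, (if G.Adj (.inr b) (.inl a) then 1 else 0) =
      ∑ a, ∑ b, if G.Adj (.inl a) (.inr b) then 1 else 0 := by
    rw [sum_comm]
    simp only [G.adj_comm]
  rw [hswap]
  ring

lemma numEdges_prod {I B : Type*} [Fintype I] [Fintype B] (G : SimpleGraph (I × B))
    [DecidableRel G.Adj] [∀ i, DecidableRel (G.comap (Prod.mk i)).Adj]
    (h : ∀ u v, G.Adj u v → u.1 = v.1) : numEdges G = ∑ i, numEdges (G.comap (Prod.mk i)) := by
  classical
  refine Nat.eq_of_mul_eq_mul_left two_pos ?_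
  simp only [numEdges, mul_sum, SimpleGraph.two_mul_card_edgeFinset, card_filter,
    Fintype.sum_prod_type, SimpleGraph.comap_adj]
  refine sum_congr rfl fun i _ => sum_congr rfl fun b _ => ?_
  refine sum_eq_single i (fun j _ hji => ?_) (by simp)
  exact sum_eq_zero fun c _ => if_neg fun hadj => hji (h _ _ hadj).symm

end EdgeCounts

section ClusterGraph

variable {V ι : Type*}

/-- The cluster graph of a labelling `f`: the disjoint union of the cliques on the sets of equally
labelled vertices. With `f = ζ.part` its edges are the vertex pairs inside the clusters of a
clustering `ζ`. -/
def clusterGraph (f : V → ι) : SimpleGraph V where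
  Adj u v := u ≠ v ∧ f u = f v
  symm := ⟨fun _ _ h => ⟨h.1.symm, h.2.symm⟩⟩
  loopless := ⟨fun _ h => h.1 rfl⟩

@[simp]
lemma clusterGraph_adj {f : V → ι} {u v : V} : (clusterGraph f).Adj u v ↔ u ≠ v ∧ f u = f v :=
  Iff.rfl

instance [DecidableEq V] [DecidableEq ι] (f : V → ι) : DecidableRel (clusterGraph f).Adj :=
  fun u v => inferInstanceAs (Decidable (u ≠ v ∧ f u = f v))

variable [Fintype V] [DecidableEq V]

lemma numEdges_clusterGraph_const (a : ι) [DecidableEq ι] :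
    numEdges (clusterGraph fun _ : V => a) = numPairs V :=
  (numEdges_congr fun u v => by simp).trans numPairs_eq_numEdges_top.symm

lemma two_mul_numEdges_clusterGraph_add_card [DecidableEq ι] (f : V → ι) :
    2 * numEdges (clusterGraph f) + Fintype.card V = ∑ u, #{v | f v = f u} := by
  rw [numEdges, ← SimpleGraph.sum_degrees_eq_twice_card_edges, ← card_univ, card_eq_sum_ones,
    ← sum_add_distrib]
  refine sum_congr rfl fun u _ => ?_
  rw [← SimpleGraph.card_neighborFinset_eq_degree,
    ← card_erase_add_one (s := {v | f v = f u}) (a := u) (by simp)]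
  congr 2
  ext v
  simp [eq_comm]

lemma exists_clusterGraph_part_eq (f : V → ι) :
    ∃ ζ : Clustering V, clusterGraph ζ.part = clusterGraph f := by
  classical
  have : DecidableRel (Setoid.ker f).r := fun u v => inferInstanceAs (Decidable (f u = f v))
  refine ⟨Finpartition.ofSetoid (Setoid.ker f), ?_⟩
  ext u v
  rw [clusterGraph_adj, clusterGraph_adj,
    ← Finpartition.mem_part_iff_part_eq_part _ (mem_univ u) (mem_univ v),
    Finpartition.mem_part_ofSetoid_iff_rel, Setoid.ker_def, eq_comm (a := f u)]

lemma edgesWithin_top (C : Finset V) : edgesWithin ⊤ C = (#C).choose 2 := by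
  rw [edgesWithin, ← Sym2.card_image_offDiag]
  congr 1
  ext e
  induction e using Sym2.ind with
  | _ u v =>
    simp only [mem_filter, SimpleGraph.mem_edgeFinset, SimpleGraph.mem_edgeSet,
      SimpleGraph.top_adj, mk_mem_sym2_iff, mem_image, mem_offDiag, Prod.exists,
      Function.uncurry_apply_pair, Sym2.eq_iff]
    grind

lemma intraEdges_eq_numEdges (G : SimpleGraph V) [DecidableRel G.Adj] (ζ : Clustering V) :
    intraEdges G ζ = numEdges (G ⊓ clusterGraph ζ.part) := by
  unfold intraEdges edgesWithin numEdges
  rw [← card_biUnion]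
  · congr 1
    ext e
    induction e using Sym2.ind with
    | _ u v =>
      simp only [mem_biUnion, mem_filter, SimpleGraph.mem_edgeFinset, SimpleGraph.mem_edgeSet,
        mk_mem_sym2_iff, SimpleGraph.inf_adj, clusterGraph_adj]
      constructor
      · rintro ⟨C, hC, h, hu, hv⟩
        exact ⟨h, h.ne, by rw [ζ.part_eq_of_mem hC hu, ζ.part_eq_of_mem hC hv]⟩
      · rintro ⟨h, -, huv⟩
        exact ⟨ζ.part u, ζ.part_mem.2 (mem_univ _), h, ζ.mem_part (mem_univ _),
          huv ▸ ζ.mem_part (mem_univ _)⟩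
  · intro C hC D hD hne
    rw [Function.onFun, disjoint_left]
    intro e
    induction e using Sym2.ind with
    | _ u v =>
      simp only [mem_filter, mk_mem_sym2_iff]
      rintro ⟨-, hu, -⟩ ⟨-, hu', -⟩
      exact hne (ζ.eq_of_mem_parts hC hD hu hu')

lemma intraPairs_eq_numEdges (ζ : Clustering V) :
    intraPairs ζ = numEdges (clusterGraph ζ.part) := by
  have htop : intraPairs ζ = intraEdges ⊤ ζ := sum_congr rfl fun C _ => (edgesWithin_top C).symm
  rw [htop, intraEdges_eq_numEdges]
  exact numEdges_congr fun u v => by simp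

lemma intraEdges_le_numEdges (G : SimpleGraph V) [DecidableRel G.Adj] (ζ : Clustering V) :
    intraEdges G ζ ≤ numEdges G :=
  intraEdges_eq_numEdges G ζ ▸ numEdges_mono inf_le_left

lemma intraEdges_le_intraPairs (G : SimpleGraph V) [DecidableRel G.Adj] (ζ : Clustering V) :
    intraEdges G ζ ≤ intraPairs ζ :=
  intraEdges_eq_numEdges G ζ ▸ intraPairs_eq_numEdges ζ ▸ numEdges_mono inf_le_right

lemma intraPairs_le_numPairs (ζ : Clustering V) : intraPairs ζ ≤ numPairs V :=
  intraPairs_eq_numEdges ζ ▸ numEdges_le_numPairs _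

variable [DecidableEq ι]

lemma exists_dominant_label [Nonempty V] (f : V → ι) :
    ∃ l, 2 * numEdges (clusterGraph f) + Fintype.card V * #{v | f v ≠ l} ≤ 2 * numPairs V := by
  obtain ⟨u, hu⟩ := Finite.exists_max fun u => #{v | f v = f u}
  refine ⟨f u, ?_⟩
  have hsum : 2 * numEdges (clusterGraph f) + Fintype.card V ≤
      Fintype.card V * #{v | f v = f u} := by
    rw [two_mul_numEdges_clusterGraph_add_card]
    exact (sum_le_card_nsmul _ _ _ fun v _ => hu v).trans (by simp)
  have hsplit : #{v | f v = f u} + #{v | f v ≠ f u} = Fintype.card V :=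
    card_filter_add_card_filter_not _
  have htotal := two_mul_numEdges_clusterGraph_add_card fun _ : V => ()
  simp only [numEdges_clusterGraph_const, filter_true, card_univ, sum_const, smul_eq_mul] at htotal
  nlinarith

end ClusterGraph

section Tail

/-- The numerator of the surprise of a clustering with `a` intracluster pairs and `e` intracluster
edges, in a graph with `p` vertex pairs and `m` edges. -/
def tailCount (p m a e : ℕ) : ℕ :=
  ∑ i ∈ Icc e m, a.choose i * (p - a).choose (m - i)

lemma surprise_eq {V : Type*} [Fintype V] [DecidableEq V] (G : SimpleGraph V)
    [DecidableRel G.Adj] (ζ : Clustering V) :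
    surprise G ζ = ((numPairs V).choose (numEdges G) : ℝ)⁻¹ *
      tailCount (numPairs V) (numEdges G) (intraPairs ζ) (intraEdges G ζ) := by
  rw [surprise, tailCount, ← sum_div, div_eq_inv_mul]
  push_cast
  rfl

lemma tailCount_self {p m a : ℕ} (h : a ≤ m) : tailCount p m a a = (p - a).choose (m - a) := by
  rw [tailCount, sum_eq_single_of_mem a (left_mem_Icc.2 h)]
  · simp
  · intro i hi hne
    rw [Nat.choose_eq_zero_of_lt ((mem_Icc.1 hi).1.lt_of_ne' hne), zero_mul]

lemma choose_le_tailCount {p m a e : ℕ} (h : e ≤ m) : a.choose m ≤ tailCount p m a e := by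
  have := single_le_sum (f := fun i => a.choose i * (p - a).choose (m - i))
    (fun _ _ => Nat.zero_le _) (right_mem_Icc.2 h)
  simpa [tailCount] using this

lemma choose_le_choose_add_add (n k d : ℕ) : n.choose k ≤ (n + d).choose (k + d) := by
  induction d with
  | zero => exact le_rfl
  | succ d ih => exact ih.trans (Nat.choose_succ_succ .. ▸ Nat.le_add_right _ _)

lemma choose_lt_choose_add_add {n k d : ℕ} (hkn : k < n) (hd : 0 < d) :
    n.choose k < (n + d).choose (k + d) := by
  obtain ⟨d, rfl⟩ := Nat.exists_eq_add_of_lt hd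
  have hstep : n.choose k < (n + 1).choose (k + 1) := by
    rw [Nat.choose_succ_succ]
    exact Nat.lt_add_of_pos_right (Nat.choose_pos hkn)
  simpa [add_assoc, add_comm 1] using hstep.trans_le (choose_le_choose_add_add _ _ d)

lemma choose_sub_le_tailCount {p m a e : ℕ} (hea : e ≤ a) (hap : a ≤ p) (hem : e ≤ m) :
    (p - e).choose (m - e) ≤ tailCount p m a e := by
  calc (p - e).choose (m - e)
      = ((a - e) + (p - a)).choose (m - e) := by congr 1; omega
    _ = ∑ j ∈ range (m - e + 1), (a - e).choose j * (p - a).choose (m - e - j) := by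
        rw [Nat.add_choose_eq, Nat.sum_antidiagonal_eq_sum_range_succ
          fun i j => (a - e).choose i * (p - a).choose j]
    _ ≤ ∑ j ∈ range (m - e + 1), a.choose (e + j) * (p - a).choose (m - (e + j)) := by
        refine sum_le_sum fun j _ => ?_
        rw [Nat.sub_sub]
        gcongr
        simpa [hea, add_comm e] using choose_le_choose_add_add (a - e) j e
    _ = tailCount p m a e := by
        rw [tailCount, ← Ico_succ_right_eq_Icc, sum_Ico_eq_sum_range, Order.succ_eq_add_one,
          Nat.sub_add_comm hem]

lemma choose_sub_lt_tailCount {p m a e c : ℕ} (hea : e ≤ a) (hap : a ≤ p) (hec : e < c)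
    (hcm : c ≤ m) (hmp : m < p) : (p - c).choose (m - c) < tailCount p m a e := by
  refine lt_of_lt_of_le ?_ (choose_sub_le_tailCount hea hap (hec.le.trans hcm))
  have h := choose_lt_choose_add_add (n := p - c) (k := m - c) (d := c - e) (by omega) (by omega)
  rwa [tsub_add_tsub_cancel (by omega) hec.le, tsub_add_tsub_cancel hcm hec.le] at h

lemma pow_le_choose_add {k d m : ℕ} (h : k * d ≤ m + 1) : k ^ d ≤ (m + d).choose m := by
  have hmul : (m + 1) ^ d ≤ d.factorial * (m + d).choose d :=
    (Nat.pow_succ_le_ascFactorial (m + 1) d).trans_eq (Nat.ascFactorial_eq_factorial_mul_choose m d)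
  refine Nat.le_of_mul_le_mul_left (c := d.factorial) ?_ d.factorial_pos
  calc d.factorial * k ^ d ≤ d ^ d * k ^ d := Nat.mul_le_mul_right _ d.factorial_le_pow
    _ = (k * d) ^ d := by rw [mul_pow, mul_comm]
    _ ≤ (m + 1) ^ d := Nat.pow_le_pow_left h d
    _ ≤ d.factorial * (m + d).choose m := by rwa [Nat.choose_symm_add]

end Tail

section ReductionGraph

variable {X ι : Type*} {M : Finset (Finset X)}

lemma redGraph_ne_top (h : 1 < #M) : redGraph M ≠ ⊤ := by
  obtain ⟨S, hS, T, hT, hST⟩ := one_lt_card.1 h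
  have : NeZero (param M ^ 2) := ⟨pow_ne_zero 2 (by unfold param; omega)⟩
  intro htop
  have hadj : (redGraph M).Adj (.inr (⟨S, hS⟩, 0)) (.inr (⟨T, hT⟩, 0)) := by
    rw [htop]
    simpa using hST
  exact hST (congrArg Subtype.val hadj.1)

lemma numPairs_redVertex [Fintype X] :
    numPairs (RedVertex M) = (#M * param M ^ 2 + Fintype.card X).choose 2 := by
  simp [numPairs, add_comm]

variable [DecidableEq ι]

/-- The number of equally labelled edges between element vertices and clique vertices. -/
def numLinks (f : RedVertex M → ι) : ℕ :=
  ∑ S : M, ∑ x ∈ S.1, #{i | f (.inr (S, i)) = f (.inl x)}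

lemma numLinks_const (hM : ∀ S ∈ M, #S = 3) (a : ι) :
    numLinks (fun _ : RedVertex M => a) = param M * param M ^ 2 := by
  have hterm : ∀ S ∈ (univ : Finset M), ∑ _x ∈ S.1, #{_i : Fin (param M ^ 2) | a = a} =
      3 * param M ^ 2 := fun S _ => by simp [hM S S.2]
  rw [numLinks, sum_const_nat hterm, card_univ, Fintype.card_coe, param]
  ring

lemma numLinks_le (hM : ∀ S ∈ M, #S = 3) (f : RedVertex M → ι) :
    numLinks f ≤ param M * param M ^ 2 := by
  rw [← numLinks_const hM ()]
  exact sum_le_sum fun S _ => sum_le_sum fun x _ => card_le_card fun i _ => by simp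

variable [Fintype X] [DecidableEq X]

instance (f : RedVertex M → ι) : DecidableRel (redGraph M ⊓ clusterGraph f).Adj :=
  SimpleGraph.Inf.adjDecidable _ _ _

lemma numEdges_redGraph_inf_clusterGraph (f : RedVertex M → ι) :
    numEdges (redGraph M ⊓ clusterGraph f) =
      ∑ S : M, numEdges (clusterGraph fun i => f (.inr (S, i))) + numLinks f +
        numEdges (clusterGraph fun x => f (.inl x)) := by
  have hsame : ∀ u v : M × Fin (param M ^ 2),
      (redGraph M ⊓ clusterGraph f).Adj (.inr u) (.inr v) → u.1 = v.1 := fun _ _ h => h.1.1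
  have hlinks : #{q : X × M × Fin (param M ^ 2) |
      (redGraph M ⊓ clusterGraph f).Adj (.inl q.1) (.inr q.2)} = numLinks f := by
    have hadj : ∀ (x : X) (S : M) (i : Fin (param M ^ 2)),
        (redGraph M ⊓ clusterGraph f).Adj (.inl x) (.inr (S, i)) ↔
          x ∈ S.1 ∧ f (.inr (S, i)) = f (.inl x) := fun x S i =>
      ⟨fun h => ⟨h.1, h.2.2.symm⟩, fun h => ⟨h.1, Sum.inl_ne_inr, h.2.symm⟩⟩
    simp only [numLinks, card_filter, Fintype.sum_prod_type, hadj, ite_and]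
    rw [sum_comm]
    refine sum_congr rfl fun S _ => ?_
    rw [← sum_filter_add_sum_filter_not univ (· ∈ S.1), filter_univ_mem]
    simp +contextual [sum_eq_zero]
  have helems : numEdges ((redGraph M ⊓ clusterGraph f).comap Sum.inl) =
      numEdges (clusterGraph fun x => f (.inl x)) :=
    numEdges_congr fun x y => ⟨fun h => ⟨h.1, h.2.2⟩, fun h => ⟨h.1, by simpa using h⟩⟩
  have hcliques : ∀ S : M, numEdges (((redGraph M ⊓ clusterGraph f).comap Sum.inr).comap
      (Prod.mk S)) = numEdges (clusterGraph fun i => f (.inr (S, i))) := fun S =>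
    numEdges_congr fun i j => ⟨fun h => ⟨h.1.2, h.2.2⟩, fun h => ⟨⟨rfl, h.1⟩, by simpa using h⟩⟩
  rw [numEdges_sum, numEdges_prod _ hsame, hlinks, helems]
  simp only [hcliques]
  ring

lemma numEdges_redGraph (hM : ∀ S ∈ M, #S = 3) :
    numEdges (redGraph M) =
      #M * (param M ^ 2).choose 2 + param M * param M ^ 2 + (Fintype.card X).choose 2 := by
  have hinf : numEdges (redGraph M) = numEdges (redGraph M ⊓ clusterGraph fun _ => ()) :=
    numEdges_congr fun u v => by simpa using SimpleGraph.Adj.ne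
  rw [hinf, numEdges_redGraph_inf_clusterGraph, numLinks_const hM]
  simp [numEdges_clusterGraph_const, numPairs]

end ReductionGraph

section ExactCover

variable {X : Type*} {M : Finset (Finset X)}

lemma hasExactCover_iff_exists_labelling :
    HasExactCover M ↔ ∃ g : X → M, ∀ x y, y ∈ (g x).1 ↔ g y = g x := by
  classical
  constructor
  · rintro ⟨R, hRM, hR⟩
    choose g hg hunique using hR
    refine ⟨fun x => ⟨g x, hRM (hg x).1⟩, fun x y => ?_⟩
    rw [Subtype.mk_eq_mk]
    exact ⟨fun h => (hunique y (g x) ⟨(hg x).1, h⟩).symm, fun h => by simpa [h] using (hg y).2⟩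
  · rintro ⟨g, hg⟩
    refine ⟨{S ∈ M | ∃ x, (g x).1 = S}, filter_subset _ _, fun x => ⟨g x, ?_, ?_⟩⟩
    · simpa using (hg x x).2 rfl
    · rintro S ⟨hS, hxS⟩
      obtain ⟨-, z, rfl⟩ := mem_filter.1 hS
      rw [(hg z x).1 hxS]

/-- The labelling of the vertices of the reduction graph that puts every element `x` into the
cluster of the clique of `g x`. -/
def coverLabel (g : X → M) : RedVertex M → M :=
  Sum.elim g Prod.fst

lemma clusterGraph_coverLabel_le_redGraph {g : X → M} (hg : ∀ x, x ∈ (g x).1) :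
    clusterGraph (coverLabel g) ≤ redGraph M := by
  have hmem : ∀ {x S}, g x = S → x ∈ S.1 := fun {x} _ h => h ▸ hg x
  rintro (x | ⟨S, i⟩) (y | ⟨T, j⟩) ⟨hne, heq⟩
  · exact fun h => hne (congrArg Sum.inl h)
  · exact hmem heq
  · exact hmem heq.symm
  · exact ⟨heq, fun h => hne (congrArg Sum.inr (Prod.ext heq h))⟩

variable [Fintype X]

lemma card_le_param (hM : ∀ S ∈ M, #S = 3) (hcov : ∀ x : X, ∃ S ∈ M, x ∈ S) :
    Fintype.card X ≤ param M := by
  classical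
  have hunion : (univ : Finset X) = M.biUnion id := by
    ext x
    simpa using hcov x
  rw [← card_univ, hunion, param, mul_comm]
  exact card_biUnion_le_card_mul _ _ _ fun S hS => (hM S hS).le

variable [DecidableEq X]

lemma hasExactCover_of_card_mul_le {k : ℕ} (hM : ∀ S ∈ M, #S ≤ k) {g : X → M}
    (hg : ∀ x, x ∈ (g x).1)
    (h : k * Fintype.card X ≤ 2 * numEdges (clusterGraph g) + Fintype.card X) :
    HasExactCover M := by
  have hsub : ∀ x, ({y | g y = g x} : Finset X) ⊆ (g x).1 := by
    intro x y hy
    exact (mem_filter.1 hy).2 ▸ hg y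
  have hcard : ∀ x ∈ univ, #{y | g y = g x} ≤ k := fun x _ =>
    (card_le_card (hsub x)).trans (hM _ (g x).2)
  have hsum : ∑ x, #{y | g y = g x} = ∑ _x : X, k := by
    refine le_antisymm (sum_le_sum hcard) ?_
    rw [← two_mul_numEdges_clusterGraph_add_card]
    simpa [mul_comm k] using h
  have hfibre : ∀ x, ({y | g y = g x} : Finset X) = (g x).1 := fun x =>
    eq_of_subset_of_card_le (hsub x)
      ((hM _ (g x).2).trans_eq ((sum_eq_sum_iff_of_le hcard).1 hsum x (mem_univ x)).symm)
  refine hasExactCover_iff_exists_labelling.2 ⟨g, fun x y => ?_⟩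
  rw [← hfibre x, mem_filter_univ]

variable (M) in
/-- The number of intracluster pairs of the clusterings that come from exact covers: the elements
split into triples, each of which is merged with the clique of its set. All these pairs are
edges. -/
def coverPairs : ℕ :=
  #M * (param M ^ 2).choose 2 + Fintype.card X * param M ^ 2 + Fintype.card X

lemma numLinks_coverLabel {g : X → M} (hg : ∀ x, x ∈ (g x).1) :
    numLinks (coverLabel g) = Fintype.card X * param M ^ 2 := by
  have hfibre : ∀ (S : M) (x : X), #{_i : Fin (param M ^ 2) | S = g x} =
      if S = g x then param M ^ 2 else 0 := fun S x => by split_ifs with h <;> simp [h]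
  calc numLinks (coverLabel g)
      = ∑ S : M, ∑ x ∈ S.1, if S = g x then param M ^ 2 else 0 := by
        simp only [← hfibre]
        rfl
    _ = ∑ S : M, ∑ x : X, if S = g x then param M ^ 2 else 0 :=
        sum_congr rfl fun S _ => sum_subset (subset_univ _) fun x _ hx =>
          if_neg fun h : S = g x => hx (h ▸ hg x)
    _ = Fintype.card X * param M ^ 2 := by
        rw [sum_comm]
        simp

lemma numEdges_redGraph_inf_clusterGraph_coverLabel (hM : ∀ S ∈ M, #S = 3) {g : X → M}
    (hg : ∀ x y, y ∈ (g x).1 ↔ g y = g x) :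
    numEdges (redGraph M ⊓ clusterGraph (coverLabel g)) = coverPairs M := by
  have hcliques : ∑ S : M, numEdges (clusterGraph fun i => coverLabel g (.inr (S, i))) =
      #M * (param M ^ 2).choose 2 := by
    have hterm : ∀ S ∈ (univ : Finset M), numEdges (clusterGraph fun i =>
        coverLabel g (.inr (S, i))) = (param M ^ 2).choose 2 := fun S _ =>
      (numEdges_clusterGraph_const S).trans (by simp [numPairs])
    rw [sum_const_nat hterm, card_univ, Fintype.card_coe]
  have helems : numEdges (clusterGraph g) = Fintype.card X := by
    have h := two_mul_numEdges_clusterGraph_add_card g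
    have hfibre : ∀ x ∈ univ, #{y | g y = g x} = 3 := fun x _ => by
      rw [← hM _ (g x).2]
      congr 1
      ext y
      simp [hg]
    rw [sum_const_nat hfibre, card_univ] at h
    omega
  rw [numEdges_redGraph_inf_clusterGraph, hcliques, numLinks_coverLabel fun x => (hg x x).2 rfl]
  exact congrArg _ helems

lemma exists_clustering_of_hasExactCover (hM : ∀ S ∈ M, #S = 3) (h : HasExactCover M) :
    ∃ ζ : Clustering (RedVertex M),
      intraEdges (redGraph M) ζ = coverPairs M ∧ intraPairs ζ = coverPairs M := by
  obtain ⟨g, hg⟩ := hasExactCover_iff_exists_labelling.1 h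
  obtain ⟨ζ, hζ⟩ := exists_clusterGraph_part_eq (coverLabel g)
  have hle := clusterGraph_coverLabel_le_redGraph fun x => (hg x x).2 rfl
  rw [← inf_eq_right, ← hζ] at hle
  have hpairs : intraPairs ζ = intraEdges (redGraph M) ζ := by
    rw [intraPairs_eq_numEdges, intraEdges_eq_numEdges]
    exact numEdges_congr fun u v => by rw [hle]
  have hedges : intraEdges (redGraph M) ζ = coverPairs M := by
    rw [intraEdges_eq_numEdges, ← numEdges_redGraph_inf_clusterGraph_coverLabel hM hg]
    exact numEdges_congr fun u v => by rw [hζ]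
  exact ⟨ζ, hedges, hpairs.trans hedges⟩

end ExactCover

section LowSurprise

variable {X ι : Type*} [DecidableEq ι] {M : Finset (Finset X)}

/-- The number of clique vertices whose label differs from the label that `l` assigns to their
clique. -/
def numDeviating (f : RedVertex M → ι) (l : M → ι) : ℕ :=
  ∑ S : M, #{i | f (.inr (S, i)) ≠ l S}

/-- The number of incidences `x ∈ S` for which the label of `x` is the label that `l` assigns to
the clique of `S`. -/
def numMatched (f : RedVertex M → ι) (l : M → ι) : ℕ :=
  ∑ S : M, #{x ∈ S.1 | f (.inl x) = l S}

lemma numLinks_le_numMatched (hM : ∀ S ∈ M, #S = 3) (f : RedVertex M → ι) (l : M → ι) :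
    numLinks f ≤ param M ^ 2 * numMatched f l + 3 * numDeviating f l := by
  have hlink : ∀ (S : M) (x : X), #{i | f (.inr (S, i)) = f (.inl x)} ≤
      (if f (.inl x) = l S then param M ^ 2 else 0) + #{i | f (.inr (S, i)) ≠ l S} := by
    intro S x
    split_ifs with hx
    · exact ((card_le_univ _).trans_eq (Fintype.card_fin _)).trans (Nat.le_add_right _ _)
    · rw [zero_add]
      exact card_le_card (monotone_filter_right _ fun i _ hi h => hx (hi.symm.trans h))
  rw [numLinks, numMatched, numDeviating, mul_sum, mul_sum, ← sum_add_distrib]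
  refine sum_le_sum fun S _ => (sum_le_sum fun x _ => hlink S x).trans_eq ?_
  rw [sum_add_distrib, ← sum_filter, sum_const, sum_const, hM S S.2, smul_eq_mul, smul_eq_mul,
    mul_comm]

variable [Fintype X] [DecidableEq X]

lemma exists_dominant_labels (h : 0 < param M) {f : RedVertex M → ι}
    (hf : coverPairs M ≤ numEdges (redGraph M ⊓ clusterGraph f)) :
    ∃ l : M → ι, param M ^ 2 * numDeviating f l +
        2 * (Fintype.card X * param M ^ 2 + Fintype.card X) ≤
      2 * numLinks f + 2 * numEdges (clusterGraph fun x => f (.inl x)) := by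
  have : NeZero (param M ^ 2) := ⟨(pow_pos h 2).ne'⟩
  choose l hl using fun S : M => exists_dominant_label fun i => f (.inr (S, i))
  refine ⟨l, ?_⟩
  have hcliques : 2 * ∑ S : M, numEdges (clusterGraph fun i => f (.inr (S, i))) +
      param M ^ 2 * numDeviating f l ≤ 2 * (#M * (param M ^ 2).choose 2) := by
    have hsum := sum_le_sum fun S (_ : S ∈ univ) => hl S
    simp only [numPairs, sum_add_distrib, ← mul_sum, sum_const, card_univ, Fintype.card_fin,
      Fintype.card_coe, smul_eq_mul] at hsum
    rw [numDeviating]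
    linarith
  rw [coverPairs, numEdges_redGraph_inf_clusterGraph] at hf
  linarith

lemma numMatched_eq_card {l : M → ι} (hl : l.Injective) (f : RedVertex M → ι) :
    numMatched f l = #{x | ∃ S : M, x ∈ S.1 ∧ f (.inl x) = l S} := by
  have hdisj : Set.PairwiseDisjoint ((univ : Finset M) : Set M)
      fun S => {x ∈ S.1 | f (.inl x) = l S} := by
    refine fun S _ T _ hST => disjoint_left.2 fun x hS hT => hST (hl ?_)
    exact (mem_filter.1 hS).2.symm.trans (mem_filter.1 hT).2
  rw [numMatched, ← card_biUnion hdisj]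
  congr 1
  ext x
  simp

lemma hasExactCover_of_injective (hM : ∀ S ∈ M, #S = 3) (hX : Fintype.card X ≤ param M)
    (hr : 3 ≤ param M) {f : RedVertex M → ι} {l : M → ι} (hl : l.Injective)
    (h : param M ^ 2 * numDeviating f l +
        2 * (Fintype.card X * param M ^ 2 + Fintype.card X) ≤
      2 * numLinks f + 2 * numEdges (clusterGraph fun x => f (.inl x))) :
    HasExactCover M := by
  have hlinks := numLinks_le_numMatched hM f l
  have hdev : 6 * numDeviating f l ≤ param M ^ 2 * numDeviating f l :=
    Nat.mul_le_mul_right _ (by nlinarith)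
  have helems : 2 * numEdges (clusterGraph fun x => f (.inl x)) ≤ param M ^ 2 :=
    (two_mul_numEdges_le _).trans (Nat.pow_le_pow_left hX 2)
  have hmatched : Fintype.card X ≤ numMatched f l := by
    by_contra! hlt
    have hloss : param M ^ 2 * (numMatched f l + 1) ≤ param M ^ 2 * Fintype.card X :=
      Nat.mul_le_mul_left _ hlt
    linarith
  have hmatched' : ∀ x, ∃ S : M, x ∈ S.1 ∧ f (.inl x) = l S := by
    rw [numMatched_eq_card hl, ← card_univ] at hmatched
    simpa using eq_univ_of_card _ ((card_le_univ _).antisymm hmatched)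
  choose g hg hgl using hmatched'
  refine hasExactCover_of_card_mul_le (fun S hS => (hM S hS).le) hg ?_
  have hcluster : numEdges (clusterGraph g) = numEdges (clusterGraph fun x => f (.inl x)) :=
    numEdges_congr fun x y => by simp [hgl, hl.eq_iff]
  have hle : param M ^ 2 * numMatched f l ≤ param M ^ 2 * Fintype.card X :=
    Nat.mul_le_mul_left _ (numMatched_eq_card hl f ▸ card_le_univ _)
  linarith

lemma four_mul_numEdges_add_pow_four_le {f : RedVertex M → ι} {l : M → ι} {S T : M} (hST : S ≠ T)
    (hl : l S = l T) (h : 2 * numDeviating f l ≤ param M ^ 2) :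
    4 * numEdges (redGraph M ⊓ clusterGraph f) + param M ^ 4 ≤ 4 * numEdges (clusterGraph f) := by
  let dominantPart (U : M) : Finset (RedVertex M) :=
    ({i | f (.inr (U, i)) = l U} : Finset _).map
      ⟨fun i => .inr (U, i), fun i j h => by simpa using h⟩
  have hcard : ∀ U, param M ^ 2 ≤ 2 * #(dominantPart U) := by
    intro U
    have hdev : #{i | f (.inr (U, i)) ≠ l U} ≤ numDeviating f l :=
      single_le_sum (f := fun U : M => #{i | f (.inr (U, i)) ≠ l U})
        (fun _ _ => Nat.zero_le _) (mem_univ U)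
    have hsplit : #{i | f (.inr (U, i)) = l U} + #{i | f (.inr (U, i)) ≠ l U} = param M ^ 2 :=
      (card_filter_add_card_filter_not _).trans (card_fin _)
    rw [card_map]
    linarith
  have hcross := numEdges_add_card_mul_card_le (G := redGraph M ⊓ clusterGraph f)
    (H := clusterGraph f) inf_le_right (A := dominantPart S) (B := dominantPart T) ?_ ?_
  · have hprod := Nat.mul_le_mul (hcard S) (hcard T)
    linarith
  · simp only [dominantPart, forall_mem_map, mem_filter_univ]
    exact fun i hi j hj => ⟨fun h => hST (congrArg Prod.fst (Sum.inr_injective h)),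
      hi.trans (hl.trans hj.symm)⟩
  · simp only [dominantPart, forall_mem_map]
    exact fun i _ j _ h => hST h.1.1

lemma hasExactCover_or_dense (hM : ∀ S ∈ M, #S = 3) (hX : Fintype.card X ≤ param M)
    (hr : 5 ≤ param M) {f : RedVertex M → ι}
    (hf : coverPairs M ≤ numEdges (redGraph M ⊓ clusterGraph f)) :
    HasExactCover M ∨
      4 * numEdges (redGraph M ⊓ clusterGraph f) + param M ^ 4 ≤
        4 * numEdges (clusterGraph f) := by
  obtain ⟨l, hl⟩ := exists_dominant_labels (by omega) hf
  by_cases hinj : l.Injective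
  · exact .inl (hasExactCover_of_injective hM hX (by omega) hinj hl)
  · obtain ⟨S, T, hlST, hST⟩ := Function.not_injective_iff.1 hinj
    refine .inr (four_mul_numEdges_add_pow_four_le hST hlST ?_)
    have hlinks := numLinks_le hM f
    have helems : 2 * numEdges (clusterGraph fun x => f (.inl x)) ≤ param M ^ 2 :=
      (two_mul_numEdges_le _).trans (Nat.pow_le_pow_left hX 2)
    have hdev : numDeviating f l ≤ 2 * param M + 1 := by
      refine Nat.le_of_mul_le_mul_left (c := param M ^ 2) ?_ (by positivity)
      calc param M ^ 2 * numDeviating f l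
          ≤ 2 * (param M * param M ^ 2) + param M ^ 2 := by omega
        _ = param M ^ 2 * (2 * param M + 1) := by ring
    nlinarith

end LowSurprise

section Threshold

variable {X : Type*} [Fintype X] {M : Finset (Finset X)}

lemma numPairs_redVertex_lt (hX : Fintype.card X ≤ param M) (hr : 2 ≤ param M) :
    numPairs (RedVertex M) < param M ^ 6 := by
  have hcard : #M * param M ^ 2 + Fintype.card X < param M ^ 3 := by
    have hcube : 3 * (#M * param M ^ 2) = param M ^ 3 := by
      rw [← mul_assoc, ← param, pow_succ' _ 2]
    nlinarith
  calc numPairs (RedVertex M) ≤ (#M * param M ^ 2 + Fintype.card X) ^ 2 :=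
        numPairs_redVertex (M := M) ▸ Nat.choose_le_pow _ 2
    _ < (param M ^ 3) ^ 2 := Nat.pow_lt_pow_left hcard two_ne_zero
    _ = param M ^ 6 := by rw [← pow_mul]

variable [DecidableEq X]

lemma coverPairs_le_numEdges (hM : ∀ S ∈ M, #S = 3) (hne : M.Nonempty)
    (hX : Fintype.card X ≤ param M) : coverPairs M ≤ numEdges (redGraph M) := by
  obtain ⟨S, hS⟩ := hne
  have hcard : 3 ≤ Fintype.card X := hM S hS ▸ card_le_univ S
  have hlinks := Nat.mul_le_mul_right (param M ^ 2) hX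
  have hchoose := two_mul_choose_two_add_self (Fintype.card X)
  rw [numEdges_redGraph hM, coverPairs]
  nlinarith

lemma threshold_eq (hM : ∀ S ∈ M, #S = 3) (hX : Fintype.card X ≤ param M) :
    threshold M = ((numPairs (RedVertex M)).choose (numEdges (redGraph M)) : ℝ)⁻¹ *
      (numPairs (RedVertex M) - coverPairs M).choose (numEdges (redGraph M) - coverPairs M) := by
  have hpairs : (#M * param M ^ 2 + Fintype.card X).choose 2 - #M * (param M ^ 2).choose 2
      - Fintype.card X * param M ^ 2 - Fintype.card X = numPairs (RedVertex M) - coverPairs M := by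
    rw [numPairs_redVertex, coverPairs, Nat.sub_sub, Nat.sub_sub, add_assoc]
  have hedges : (3 * #M - Fintype.card X) * param M ^ 2 + (Fintype.card X).choose 2
      - Fintype.card X = numEdges (redGraph M) - coverPairs M := by
    have hlinks := Nat.mul_le_mul_right (param M ^ 2) hX
    rw [numEdges_redGraph hM, coverPairs, Nat.sub_mul, ← param]
    omega
  rw [threshold, hpairs, hedges]

lemma surprise_le_threshold_iff (hM : ∀ S ∈ M, #S = 3) (hX : Fintype.card X ≤ param M)
    (ζ : Clustering (RedVertex M)) :
    surprise (redGraph M) ζ ≤ threshold M ↔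
      tailCount (numPairs (RedVertex M)) (numEdges (redGraph M)) (intraPairs ζ)
          (intraEdges (redGraph M) ζ) ≤
        (numPairs (RedVertex M) - coverPairs M).choose
          (numEdges (redGraph M) - coverPairs M) := by
  have hpos : (0 : ℝ) < ((numPairs (RedVertex M)).choose (numEdges (redGraph M)) : ℝ)⁻¹ :=
    inv_pos.2 (Nat.cast_pos.2 (Nat.choose_pos (numEdges_le_numPairs _)))
  rw [surprise_eq, threshold_eq hM hX, mul_le_mul_iff_right₀ hpos, Nat.cast_le]

lemma numEdges_redGraph_le_coverPairs_add (hM : ∀ S ∈ M, #S = 3)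
    (hX : Fintype.card X ≤ param M) :
    numEdges (redGraph M) ≤ coverPairs M + param M ^ 3 := by
  have hchoose : (Fintype.card X).choose 2 ≤ Fintype.card X * param M ^ 2 :=
    calc (Fintype.card X).choose 2 ≤ Fintype.card X * Fintype.card X :=
          (Nat.choose_le_pow _ 2).trans_eq (sq _)
      _ ≤ Fintype.card X * param M ^ 2 :=
          Nat.mul_le_mul_left _ (hX.trans (Nat.le_self_pow two_ne_zero _))
  rw [numEdges_redGraph hM, coverPairs, pow_succ' _ 2]
  omega

lemma six_mul_pow_four_le_numEdges (hM : ∀ S ∈ M, #S = 3) (hr : 36 ≤ param M) :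
    6 * param M ^ 4 ≤ numEdges (redGraph M) := by
  have hchoose := two_mul_choose_two_add_self (param M ^ 2)
  have hcliques : 6 * (#M * (param M ^ 2).choose 2) + param M * param M ^ 2 =
      param M * param M ^ 4 := by
    have hparam : 3 * #M = param M := rfl
    calc 6 * (#M * (param M ^ 2).choose 2) + param M * param M ^ 2
        = 3 * #M * (2 * (param M ^ 2).choose 2) + param M * param M ^ 2 := by ring
      _ = param M * (2 * (param M ^ 2).choose 2 + param M ^ 2) := by rw [hparam, mul_add]
      _ = param M * param M ^ 4 := by rw [hchoose]; ring
  have hpow := Nat.mul_le_mul_right (param M ^ 4) hr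
  rw [numEdges_redGraph hM]
  omega

lemma choose_sub_lt_tailCount_of_dense (hM : ∀ S ∈ M, #S = 3) (hX : Fintype.card X ≤ param M)
    (hr : 36 ≤ param M) {a e : ℕ} (hce : coverPairs M ≤ e) (hem : e ≤ numEdges (redGraph M))
    (h : 4 * e + param M ^ 4 ≤ 4 * a) :
    (numPairs (RedVertex M) - coverPairs M).choose (numEdges (redGraph M) - coverPairs M) <
      tailCount (numPairs (RedVertex M)) (numEdges (redGraph M)) a e := by
  have hedges := numEdges_redGraph_le_coverPairs_add hM hX
  have hpow : 36 * param M ^ 3 ≤ param M ^ 4 :=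
    (Nat.mul_le_mul_right _ hr).trans_eq (pow_succ' _ 3).symm
  have hpairs : 0 < numPairs (RedVertex M) :=
    (Nat.mul_pos (by norm_num) (by positivity)).trans_le
      ((six_mul_pow_four_le_numEdges hM hr).trans (numEdges_le_numPairs _))
  have hlarge : param M * (6 * param M ^ 3) ≤ numEdges (redGraph M) + 1 := by
    linarith [six_mul_pow_four_le_numEdges hM hr]
  calc (numPairs (RedVertex M) - coverPairs M).choose (numEdges (redGraph M) - coverPairs M)
      ≤ numPairs (RedVertex M) ^ (numEdges (redGraph M) - coverPairs M) :=
        (Nat.choose_le_pow _ _).trans (Nat.pow_le_pow_left (Nat.sub_le _ _) _)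
    _ ≤ numPairs (RedVertex M) ^ param M ^ 3 := Nat.pow_le_pow_right hpairs (by omega)
    _ < (param M ^ 6) ^ param M ^ 3 :=
        Nat.pow_lt_pow_left (numPairs_redVertex_lt hX (by omega)) (by positivity)
    _ = param M ^ (6 * param M ^ 3) := (pow_mul _ _ _).symm
    _ ≤ (numEdges (redGraph M) + 6 * param M ^ 3).choose (numEdges (redGraph M)) :=
        pow_le_choose_add hlarge
    _ ≤ a.choose (numEdges (redGraph M)) := Nat.choose_le_choose _ (by omega)
    _ ≤ tailCount (numPairs (RedVertex M)) (numEdges (redGraph M)) a e := choose_le_tailCount hem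

end Threshold

end SurpriseClustering

open SurpriseClustering in
theorem theorem11_general {X : Type*} [Fintype X] [DecidableEq X] {M : Finset (Finset X)}
    (hM : ∀ S ∈ M, S.card = 3) (hX : Fintype.card X ≤ param M) (hr : 36 ≤ param M) :
    HasExactCover M ↔
      ∃ ζ : Clustering (RedVertex M), surprise (redGraph M) ζ ≤ threshold M := by
  have hcard : 1 < M.card := by unfold param at hr; omega
  have hcover := coverPairs_le_numEdges hM (Finset.card_pos.1 (by omega)) hX
  simp only [surprise_le_threshold_iff hM hX]
  constructor
  · intro h
    obtain ⟨ζ, hedges, hpairs⟩ := exists_clustering_of_hasExactCover hM h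
    exact ⟨ζ, by rw [hedges, hpairs, tailCount_self hcover]⟩
  · rintro ⟨ζ, hζ⟩
    obtain hlt | hge := lt_or_ge (intraEdges (redGraph M) ζ) (coverPairs M)
    · exact absurd hζ (choose_sub_lt_tailCount (intraEdges_le_intraPairs _ ζ)
        (intraPairs_le_numPairs ζ) hlt hcover (numEdges_lt_numPairs (redGraph_ne_top hcard))).not_ge
    · have hdense := hasExactCover_or_dense hM hX (by omega)
        (intraEdges_eq_numEdges (redGraph M) ζ ▸ hge)
      rw [← intraEdges_eq_numEdges, ← intraPairs_eq_numEdges] at hdense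
      exact hdense.resolve_right fun h => hζ.not_gt
        (choose_sub_lt_tailCount_of_dense hM hX hr hge (intraEdges_le_numEdges _ ζ) h)

theorem theorem11 :
    ∃ c : ℕ, 0 < c ∧
      ∀ (X : Type*) [Fintype X] [DecidableEq X] (M : Finset (Finset X)),
        (∀ S ∈ M, S.card = 3) →
        (∀ x : X, ∃ S ∈ M, x ∈ S) →
        c ≤ SurpriseClustering.param M →
        (SurpriseClustering.HasExactCover M ↔
          ∃ ζ : SurpriseClustering.Clustering (SurpriseClustering.RedVertex M),
            SurpriseClustering.surprise (SurpriseClustering.redGraph M) ζ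
              ≤ SurpriseClustering.threshold M) :=
  ⟨36, by norm_num, fun _ _ _ _ hM hcov hr =>
    theorem11_general hM (SurpriseClustering.card_le_param hM hcov) hr⟩
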